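/- Let $\varepsilon\in\mathbb R\setminus\{0\}$, $R\ge 0$ and $\hat R=(R^2+\tfrac14\varepsilon^2)^{1/2}>0$. Let $\mathcal W$ be the associative unital complex algebra generated by $a_-,a_+,b_-,b_+$ with relations $[a_-,a_+]=[b_-,b_+]=\varepsilon$, every $a_\pm$ commuting with every $b_\pm$. Put $$J_0=\tfrac12(a_+a_--b_+b_-),\qquad J_-=a_-b_+,\qquad K_0=\tfrac12(a_+a_-+b_+b_-+\varepsilon),\qquad \mathrm{Ad}_T(w)=[T,w].$$ Let $S(s,t,u,v)\in\mathcal W$ be the sum of all distinct words containing $a_-,a_+,b_-,b_+$ exactly $s,t,u,v$ times. These elements form a basis of $\mathcal W$; let $\mathrm{tr}$ be the linear map with $\mathrm{tr}\,S(s,t,u,v)=2S(s-1,t-1,u,v)+2S(s,t,u-1,v-1)$ (terms with a negative index are $0$), and let $\Psi=\ker(\mathrm{tr})$. Let $\rho_R:\mathcal W\to\Psi$ be the projection onto $\Psi$ with kernel $\{w(K_0-\hat R): w\in\mathcal W\}$. For $2n,\,n+r,\,n+m\in\mathbb Z$, $|r|\le n$, $|m|\le n$, let $$P(n,r,m)=\varepsilon^{m-n}\left(\frac{(n+m)!}{(2n)!\,(n-m)!}\right)^{1/2}(\mathrm{Ad}_{J_-})^{n-m}\left(a_+^{n+r}b_-^{n-r}\right).$$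 For an integer $d\ge 0$ let $h^{(\alpha,\beta)}_d(x,N)$ be the Hahn polynomial $$h^{(\alpha,\beta)}_d(x,N)=\frac{(\beta+1)_d(1-N)_d}{d!}\;{}_3F_2\!\left({-d,\ \alpha+\beta+d+1,\ -x\atop \beta+1,\ 1-N};1\right),$$ understood as a polynomial in $x$ and $N$ by cancelling the denominators of the series against the prefactor; its leading coefficient in $x$ is $(\alpha+\beta+d+1)_d/d!$. **Theorem.** The element $P(n,r,m)$ lies in $\Psi$, and, modulo the left ideal $\mathcal W(K_0-\hat R)$ (that is, $P(n,r,m)=\rho_R(\,\cdot\,)$ of the right-hand side), $$P(n,r,m)=\begin{cases} (-1)^{n-r}\varepsilon^{n-r}\binom{2n}{n+m}^{1/2}\binom{2n}{n+r}^{-1}a_+^{r+m}b_+^{r-m}\,h^{(r-m,r+m)}_{n-r}\!\left(\frac{J_0+\hat R}{\varepsilon}-\frac12,\ \frac{2\hat R}{\varepsilon}\right) & \text{for } -r\le m\le r,\\[2mm] (-1)^{n-m}\varepsilon^{n-m}\binom{2n}{n+m}^{-1/2}a_+^{r+m}b_-^{m-r}\,h^{(m-r,r+m)}_{n-m}\!\left(\frac{J_0+\hat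 R}{\varepsilon}-\frac12,\ \frac{2\hat R}{\varepsilon}+r-m\right) & \text{for } -m\le r\le m,\\[2mm] (-1)^{n-r}\varepsilon^{n+m}\binom{2n}{n+m}^{-1/2}a_-^{-r-m}b_+^{r-m}\,h^{(r-m,-r-m)}_{n+m}\!\left(\frac{J_0+\hat R}{\varepsilon}-\frac12+r+m,\ \frac{2\hat R}{\varepsilon}+r+m\right) & \text{for } m\le r\le -m,\\[2mm] (-1)^{n-m}\varepsilon^{n+r}\binom{2n}{n+m}^{1/2}\binom{2n}{n+r}^{-1}a_-^{-r-m}b_-^{m-r}\,h^{(m-r,-r-m)}_{n+r}\!\left(\frac{J_0+\hat R}{\varepsilon}-\frac12+r+m,\ \frac{2\hat R}{\varepsilon}+2r\right) & \text{for } r\le m\le -r. \end{cases}$$ -/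

import Mathlib

noncomputable section

namespace FuzzyPsi

/-- The four generators `a₋, a₊, b₋, b₊`. -/
inductive Gen
  | aM | aP | bM | bP
  deriving DecidableEq

instance : Fintype Gen where
  elems := {Gen.aM, Gen.aP, Gen.bM, Gen.bP}
  complete := by intro x; cases x <;> decide

/-- The free associative unital complex algebra on `a₋, a₊, b₋, b₊`. -/
abbrev Free := FreeAlgebra ℂ Gen

/-- The relations `[a₋, a₊] = ε`, `[b₋, b₊] = ε`, and every `a` commutes with every `b`. -/
inductive Rel (ε : ℝ) : Free → Free → Prop
  | a : Rel ε (FreeAlgebra.ι ℂ Gen.aM * FreeAlgebra.ι ℂ Gen.aP)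
      (FreeAlgebra.ι ℂ Gen.aP * FreeAlgebra.ι ℂ Gen.aM + algebraMap ℂ Free (ε : ℂ))
  | b : Rel ε (FreeAlgebra.ι ℂ Gen.bM * FreeAlgebra.ι ℂ Gen.bP)
      (FreeAlgebra.ι ℂ Gen.bP * FreeAlgebra.ι ℂ Gen.bM + algebraMap ℂ Free (ε : ℂ))
  | aPbP : Rel ε (FreeAlgebra.ι ℂ Gen.aP * FreeAlgebra.ι ℂ Gen.bP)
      (FreeAlgebra.ι ℂ Gen.bP * FreeAlgebra.ι ℂ Gen.aP)
  | aPbM : Rel ε (FreeAlgebra.ι ℂ Gen.aP * FreeAlgebra.ι ℂ Gen.bM)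
      (FreeAlgebra.ι ℂ Gen.bM * FreeAlgebra.ι ℂ Gen.aP)
  | aMbP : Rel ε (FreeAlgebra.ι ℂ Gen.aM * FreeAlgebra.ι ℂ Gen.bP)
      (FreeAlgebra.ι ℂ Gen.bP * FreeAlgebra.ι ℂ Gen.aM)
  | aMbM : Rel ε (FreeAlgebra.ι ℂ Gen.aM * FreeAlgebra.ι ℂ Gen.bM)
      (FreeAlgebra.ι ℂ Gen.bM * FreeAlgebra.ι ℂ Gen.aM)

/-- The algebra `W(ε)`, the product of two Heisenberg–Weyl algebras. -/
abbrev W (ε : ℝ) := RingQuot (Rel ε)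

/-- The image of a generator in `W(ε)`. -/
def gen (ε : ℝ) (g : Gen) : W ε := RingQuot.mkAlgHom ℂ (Rel ε) (FreeAlgebra.ι ℂ g)

def aM (ε : ℝ) : W ε := gen ε Gen.aM
def aP (ε : ℝ) : W ε := gen ε Gen.aP
def bM (ε : ℝ) : W ε := gen ε Gen.bM
def bP (ε : ℝ) : W ε := gen ε Gen.bP

/-- A complex scalar, seen in `W(ε)`. -/
def scal (ε : ℝ) (c : ℂ) : W ε := algebraMap ℂ (W ε) c

/-- `J₀ = ½ (a₊ a₋ - b₊ b₋)`. -/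
def J0 (ε : ℝ) : W ε := (1 / 2 : ℂ) • (aP ε * aM ε - bP ε * bM ε)

/-- `J₋ = a₋ b₊`. -/
def Jm (ε : ℝ) : W ε := aM ε * bP ε

/-- `K₀ = ½ (a₊ a₋ + b₊ b₋ + ε)`. -/
def K0 (ε : ℝ) : W ε := (1 / 2 : ℂ) • (aP ε * aM ε + bP ε * bM ε + scal ε ε)

/-- The adjoint action `Ad_T (w) = [T, w]`. -/
def Ad (ε : ℝ) (T w : W ε) : W ε := T * w - w * T

/-- `R̂ = (R² + ε²/4)^{1/2}`. -/
def Rhat (ε R : ℝ) : ℝ := Real.sqrt (R ^ 2 + ε ^ 2 / 4)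

/-- Exponents `(s, t, u, v)` of `a₋, a₊, b₋, b₊`. -/
abbrev Expo := ℕ × ℕ × ℕ × ℕ

/-- The number of occurrences of each generator in a word. -/
def wordExpo {N : ℕ} (w : Fin N → Gen) : Expo :=
  ((Finset.univ.filter fun i => w i = Gen.aM).card,
    (Finset.univ.filter fun i => w i = Gen.aP).card,
    (Finset.univ.filter fun i => w i = Gen.bM).card,
    (Finset.univ.filter fun i => w i = Gen.bP).card)

/-- `S(s,t,u,v)`: the sum, with coefficient `1`, of all distinct words which contain `a₋, a₊, b₋, b₊`
respectively `s, t, u, v` times. -/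
def S (ε : ℝ) (e : Expo) : W ε :=
  ∑ w ∈ (Finset.univ : Finset (Fin (e.1 + e.2.1 + e.2.2.1 + e.2.2.2) → Gen)).filter
      (fun w => wordExpo w = e),
    (List.ofFn fun i => gen ε (w i)).prod

/-- The totally symmetric polynomial `∑ cₑ S(e)` with prescribed coefficients. -/
def sym (ε : ℝ) : (Expo →₀ ℂ) →ₗ[ℂ] W ε := Finsupp.linearCombination ℂ (S ε)

/-- The formal trace of `S(s,t,u,v)`, in coordinates with respect to the `S`: the words of
`S(s,t,u,v)` that end in `a₊ a₋`, `a₋ a₊`, `b₊ b₋` or `b₋ b₊` are kept and their last two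
letters are deleted, which gives `2 S(s-1,t-1,u,v) + 2 S(s,t,u-1,v-1)`, a term with a negative
index being zero. -/
def trBasis : Expo → (Expo →₀ ℂ) := fun (s, t, u, v) =>
  (if 1 ≤ s ∧ 1 ≤ t then Finsupp.single (s - 1, t - 1, u, v) 2 else 0) +
  (if 1 ≤ u ∧ 1 ≤ v then Finsupp.single (s, t, u - 1, v - 1) 2 else 0)

/-- The formal trace, on coefficients with respect to the `S`. -/
def tr : (Expo →₀ ℂ) →ₗ[ℂ] (Expo →₀ ℂ) := Finsupp.linearCombination ℂ trBasis

/-- `Ψ`: the subspace of `W(ε)` of all formally traceless totally symmetric polynomials. -/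
def Psi (ε : ℝ) : Submodule ℂ (W ε) := (LinearMap.ker tr).map (sym ε)

/-- `ker ρ_R = { w (K₀ - R̂) | w ∈ W(ε) }`, a left ideal. -/
def kerRho (ε R : ℝ) : Ideal (W ε) := Ideal.span {K0 ε - scal ε (Rhat ε R)}

/-- `ρ_R(w) = ξ`, where `ρ_R` is the projection of `W(ε)` onto `Ψ` along `ker ρ_R`. -/
def RhoEq (ε R : ℝ) (w ξ : W ε) : Prop := ξ ∈ Psi ε ∧ w - ξ ∈ kerRho ε R

/-- A non-negative integer, given as a rational number, seen as a natural number. -/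
def toN (q : ℚ) : ℕ := ⌊q⌋₊

/-- The labels of the basis: `2n, n+r, n+m ∈ ℤ`, `|r| ≤ n`, `|m| ≤ n`. -/
def IsLabel (n r m : ℚ) : Prop :=
  (∃ z : ℤ, 2 * n = z) ∧ (∃ z : ℤ, n + r = z) ∧ (∃ z : ℤ, n + m = z) ∧ |r| ≤ n ∧ |m| ≤ n

/-- The basis element (for `ε ≠ 0`)
`P(n,r,m) = ε^{m-n} ((n+m)! / ((2n)! (n-m)!))^{1/2} (Ad J₋)^{n-m} (a₊^{n+r} b₋^{n-r})`. -/
def P (ε : ℝ) (n r m : ℚ) : W ε :=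
  ((((ε ^ toN (n - m))⁻¹ *
      Real.sqrt (((toN (n + m)).factorial : ℝ) /
        (((toN (2 * n)).factorial : ℝ) * ((toN (n - m)).factorial : ℝ))) : ℝ)) : ℂ) •
    (Ad ε (Jm ε))^[toN (n - m)] (aP ε ^ toN (n + r) * bM ε ^ toN (n - r))

/-- The Pochhammer symbol `(z)ₖ = z (z+1) ⋯ (z+k-1)`. -/
def poch (z : ℂ) (k : ℕ) : ℂ := (ascPochhammer ℂ k).eval z

/-- The Hahn polynomial `h_d^{(α,β)}(x, N)` in the normalization of Nikiforov, Suslov and Uvarov, as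
a polynomial in `x`:
`((β+1)_d (1-N)_d / d!) ₃F₂(-d, α+β+d+1, -x; β+1, 1-N; 1)`,
with the denominators `(β+1)ₖ (1-N)ₖ` of the series cancelled against `(β+1)_d (1-N)_d`, so that
it is defined for all values of `N`. For `N` a positive integer and `d < N` these are the polynomials
orthogonal on `x = 0, …, N-1` for the weight `Γ(N+α-x) Γ(β+1+x) / (Γ(x+1) Γ(N-x))`,
with leading coefficient `(α+β+d+1)_d / d!`. -/
def hahnPoly (α β : ℂ) (d : ℕ) (N : ℂ) : Polynomial ℂ :=
  Polynomial.C ((d.factorial : ℂ)⁻¹) * ∑ k ∈ Finset.range (d + 1),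
    Polynomial.C (poch (-(d : ℂ)) k * poch (α + β + d + 1) k *
        poch (β + 1 + k) (d - k) * poch (1 - N + k) (d - k) / (k.factorial : ℂ)) *
      (ascPochhammer ℂ k).comp (-Polynomial.X)

/-- `h_d^{(α,β)}(x, N)` at an element `x` of `W(ε)`. -/
def hahn (ε : ℝ) (α β : ℚ) (d : ℕ) (x : W ε) (N : ℂ) : W ε :=
  Polynomial.aeval x (hahnPoly (α : ℂ) (β : ℂ) d N)

/-- The argument `(J₀ + R̂)/ε - 1/2 + c`. -/
def hahnArg (ε R : ℝ) (c : ℚ) : W ε :=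
  ((ε : ℂ)⁻¹) • (J0 ε + scal ε (Rhat ε R)) - scal ε (1 / 2) + scal ε (c : ℂ)

/-- The size parameter `2 R̂/ε + c`. -/
def hahnSize (ε R : ℝ) (c : ℚ) : ℂ := 2 * (Rhat ε R : ℂ) / (ε : ℂ) + (c : ℂ)

/-- The binomial coefficient `(2n choose n+m)`, as a real number. -/
def binom (n m : ℚ) : ℝ := ((toN (2 * n)).choose (toN (n + m)) : ℝ)

end FuzzyPsi

end

open FuzzyPsi

noncomputable section

namespace FuzzyPsi

open Finset Polynomial

/-! The derivation `Ad_{J₋}` sends `a₊ ↦ ε b₊`, `b₋ ↦ -ε a₋` and kills `a₋` and `b₊`. The Leibniz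
rule therefore writes `P(n,r,m)` as an alternating sum of monomials `a₊^(p-i) a₋^j b₊^i b₋^(q-j)`,
`i + j = n - m`, weighted by `C(p,i) C(q,j)`, where `p = n + r` and `q = n - r` (`iterate_Ad_Jm`).

A fixed monomial can be pulled out on the left. What remains is a product of falling factorials in
the number operators `a₊a₋/ε` and `b₊b₋/ε`, shifted by the powers of `a₋` and `b₋` that were pulled
out (`monomial_eq_aeval`, `P_eq_sum`). Modulo the left ideal of `K₀ - R̂` the two shifted operators
are `x` and `N - 1 - x`, with `x` the Hahn argument and `N` the Hahn size. This leaves a scalar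
identity: `∑ wⱼ (-1)ʲ z^{(j)} (N-1-z)^{(d-j)}` is a multiple of a Hahn polynomial. Chu-Vandermonde
re-expands the left side in falling factorials of `z`, and the binomial Vandermonde identity
evaluates its coefficients (`sum_fall_eq_hahnPoly_of_left`, `sum_fall_eq_hahnPoly_of_right`). The
four cases of the theorem are the four possible signs of `r + m` and `r - m`; `d` is the smallest of
`n ± r`, `n ± m`.

For membership in `Ψ`: `Ad_{J₋}` acts on the symmetric sums `S` through an operator on coefficients
that commutes with the trace, and `a₊^p b₋^q` is a multiple of the traceless `S(0,p,q,0)`. -/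

/-! ### Falling factorials and Hahn polynomials -/

/-- The falling factorial `z (z - 1) ⋯ (z - k + 1)`. -/
def fall (z : ℂ) (k : ℕ) : ℂ := (descPochhammer ℂ k).eval z

theorem fall_add (r s : ℂ) (k : ℕ) :
    fall (r + s) k = ∑ ij ∈ antidiagonal k, (k.choose ij.1 : ℂ) * (fall r ij.1 * fall s ij.2) := by
  have h := Ring.descPochhammer_smeval_add (R := ℂ) k (Commute.all r s)
  have e : ∀ (z : ℂ) (j : ℕ), (descPochhammer ℤ j).smeval z = fall z j := by
    intro z j
    rw [fall, ← descPochhammer_map (Int.castRingHom ℂ), eval_map, ← Polynomial.eval₂_smulOneHom_eq_smeval]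
    congr 1
    ext; simp
  simpa only [e, nsmul_eq_mul] using h

theorem fall_mul (z : ℂ) (j i : ℕ) : fall z (j + i) = fall z j * fall (z - j) i := by
  rw [fall, ← descPochhammer_mul]
  simp [fall]

theorem fall_eq_poch (z : ℂ) (k : ℕ) : fall z k = poch (z - k + 1) k :=
  descPochhammer_eval_eq_ascPochhammer ℂ z k

theorem poch_neg (z : ℂ) (k : ℕ) : poch (-z) k = (-1) ^ k * fall z k :=
  ascPochhammer_eval_neg_eq_descPochhammer ℂ z k

/-- Reflection `x ↦ e - 1 - x` changes a falling factorial of length `e` by `(-1)^e` and makes the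
sign of `w` positive, so Vandermonde applies. -/
theorem fall_sub (u w : ℂ) (e : ℕ) :
    fall (u - w) e =
      (-1) ^ e * ∑ ij ∈ antidiagonal e, (e.choose ij.1 : ℂ) * (fall w ij.1 * poch (-u + ij.1) ij.2) := by
  have h1 : fall (u - w) e = (-1) ^ e * fall (w + (e - 1 - u)) e := by
    have h2 := poch_neg (u - w) e
    have h3 : fall (w + (e - 1 - u)) e = poch (-(u - w)) e := by
      rw [fall_eq_poch]; congr 1; ring
    rw [h3, h2, ← mul_assoc, ← mul_pow]; simp
  rw [h1, fall_add]
  congr 1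
  refine sum_congr rfl fun ij hij => ?_
  rw [HasAntidiagonal.mem_antidiagonal] at hij
  rw [fall_eq_poch (e - 1 - u), ← hij]
  congr 3
  push_cast; ring_nf

/-- Expansion of `∑ wⱼ (-1)ʲ z^{(j)} (N - 1 - z)^{(d - j)}` in falling factorials of `z`. -/
theorem sum_fall_mul_fall (w : ℕ → ℂ) (d : ℕ) (z N : ℂ) :
    ∑ j ∈ range (d + 1), w j * (-1) ^ j * (fall z j * fall (N - 1 - z) (d - j)) =
      (-1) ^ d * ∑ s ∈ range (d + 1),
        (∑ j ∈ range (s + 1), w j * ((d - j).choose (s - j) : ℂ)) *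
          (poch (1 - N + s) (d - s) * fall z s) := by
  have h1 : ∀ j ∈ range (d + 1), w j * (-1) ^ j * (fall z j * fall (N - 1 - z) (d - j)) =
      ∑ s ∈ Ico j (d + 1), (-1) ^ d * (w j * ((d - j).choose (s - j) : ℂ) *
          (poch (1 - N + s) (d - s) * fall z s)) := by
    intro j hj
    have hj' : j ≤ d := Nat.lt_succ_iff.mp (mem_range.mp hj)
    -- Expanding in falling factorials of `z - j` lets each term merge with `fall z j` into a single
    -- `fall z (j + i)`.
    have h2 : N - 1 - z = (N - 1 - j) - (z - j) := by ring
    rw [h2, fall_sub, Nat.sum_antidiagonal_eq_sum_range_succ_mk, sum_Ico_eq_sum_range, mul_sum,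
      mul_sum, mul_sum]
    have h3 : (d - j).succ = d + 1 - j := by omega
    rw [h3]
    refine sum_congr rfl fun i hi => ?_
    have hi' : i < d + 1 - j := mem_range.mp hi
    have h4 : d - (j + i) = d - j - i := by omega
    have h5 : (-1 : ℂ) ^ d = (-1) ^ j * (-1) ^ (d - j) := by rw [← pow_add]; congr 1; omega
    rw [fall_mul, h4, h5, Nat.add_sub_cancel_left]
    have h6 : -(N - 1 - j) + (i : ℂ) = 1 - N + ((j + i : ℕ) : ℂ) := by push_cast; ring
    simp only [h6]
    ring
  rw [sum_congr rfl h1, mul_sum]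
  simp only [sum_mul, mul_sum]
  -- Interchange of summation over the triangle `j ≤ s ≤ d`.
  rw [sum_sigma', sum_sigma']
  refine sum_nbij' (fun x => ⟨x.2, x.1⟩) (fun x => ⟨x.2, x.1⟩) ?_ ?_ ?_ ?_ ?_
  · simp only [mem_sigma, mem_range, mem_Ico]; intros; omega
  · simp only [mem_sigma, mem_range, mem_Ico]; intros; omega
  · intros; rfl
  · intros; rfl
  · intros; rfl

theorem hahnPoly_eval (α β : ℂ) (d : ℕ) (N z : ℂ) :
    (hahnPoly α β d N).eval z = ∑ s ∈ range (d + 1),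
      ((d.factorial : ℂ)⁻¹ * (d.choose s : ℂ) * poch (α + β + d + 1) s * poch (β + 1 + s) (d - s)) *
        (poch (1 - N + s) (d - s) * fall z s) := by
  rw [hahnPoly, eval_mul, eval_C, eval_finsetSum, mul_sum]
  refine sum_congr rfl fun s hs => ?_
  have h1 : eval z ((ascPochhammer ℂ s).comp (-X)) = (-1) ^ s * fall z s := by
    rw [eval_comp, eval_neg, eval_X]; exact poch_neg z s
  have h2 : fall (d : ℂ) s = s.factorial * d.choose s := by
    rw [fall, descPochhammer_eval_eq_descFactorial, Nat.descFactorial_eq_factorial_mul_choose]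
    push_cast; rfl
  have h3 : (s.factorial : ℂ) ≠ 0 := by exact_mod_cast s.factorial_ne_zero
  have h4 : ((-1 : ℂ) ^ s) * (-1) ^ s = 1 := by rw [← mul_pow]; simp
  rw [eval_mul, eval_C, h1, poch_neg, h2]
  field_simp
  linear_combination ((d.factorial : ℂ)⁻¹ * d.choose s * poch (α + β + d + 1) s * poch (β + 1 + s) (d - s) *
    poch (1 - N + s) (d - s) * fall z s : ℂ) * h4

theorem poch_natCast (a k : ℕ) : poch ((a : ℂ) + 1) k = ((a + k).factorial : ℂ) / a.factorial := by
  rw [eq_div_iff (by exact_mod_cast a.factorial_ne_zero)]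
  have := ascPochhammer_nat_eq_natCast_ascFactorial ℂ (a + 1) k
  rw [poch]
  push_cast at this
  rw [this, mul_comm]
  exact_mod_cast Nat.factorial_mul_ascFactorial a k

/-- Trinomial revision `C(p,d-j) C(d-j,d-s) = C(p,d-s) C(p-(d-s),s-j)` takes one factor out of the
sum; the rest is Vandermonde. -/
theorem sum_choose_mul_choose_of_right (p d c s : ℕ) (hs : s ≤ d) :
    ∑ j ∈ range (s + 1), (p.choose (d - j) * c.choose j) * (d - j).choose (s - j) =
      p.choose (d - s) * (p - (d - s) + c).choose s := by
  rw [Nat.add_choose_eq, Nat.sum_antidiagonal_eq_sum_range_succ_mk, mul_sum, ← sum_range_reflect]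
  refine sum_congr rfl fun j hj => ?_
  have hj' : j < s + 1 := mem_range.mp hj
  have e1 : s + 1 - 1 - j = s - j := by omega
  have e2 : s - (s - j) = j := by omega
  rw [e1, e2]
  have e3 : (d - (s - j)).choose j = (d - (s - j)).choose (d - s) := by
    rw [← Nat.choose_symm_of_eq_add]; omega
  have h := Nat.choose_mul (n := p) (k := d - (s - j)) (s := d - s) (by omega)
  have e4 : d - (s - j) - (d - s) = j := by omega
  rw [e4] at h
  rw [e3, mul_right_comm, h]; ring

/-- Trinomial revision `C(d,j) C(d-j,s-j) = C(d,s) C(s,j)`, then Vandermonde. The full Vandermonde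
sum runs to `k ≥ s`, but its terms with `j > s` vanish. -/
theorem sum_choose_mul_choose_of_left (p k d s : ℕ) (hs : s ≤ d) (hk : d ≤ k):
    ∑ j ∈ range (s + 1), (p.choose (k - j) * d.choose j) * (d - j).choose (s - j) =
      d.choose s * (p + s).choose k := by
  have hsub : range (s + 1) ⊆ range (k + 1) := range_subset_range.mpr (by omega)
  have : (p + s).choose k = ∑ j ∈ range (s + 1), p.choose (k - j) * s.choose j := by
    rw [add_comm, Nat.add_choose_eq, Nat.sum_antidiagonal_eq_sum_range_succ_mk]
    rw [← sum_subset hsub]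
    · exact sum_congr rfl fun _ _ => mul_comm _ _
    · intro j _ hj
      rw [Nat.choose_eq_zero_of_lt (by simpa using hj), zero_mul]
  rw [this, mul_sum]
  refine sum_congr rfl fun j hj => ?_
  have hj' : j < s + 1 := mem_range.mp hj
  have h := Nat.choose_mul (n := d) (k := s) (s := j) (by omega)
  rw [mul_assoc, ← h]; ring

theorem cast_add_choose (a b : ℕ) :
    ((a + b).choose a : ℂ) = ((a + b).factorial : ℂ) / (a.factorial * b.factorial) :=
  Nat.cast_add_choose ℂ

/-- The Hahn polynomial as a sum of products of falling factorials. -/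
theorem sum_fall_eq_hahnPoly (w : ℕ → ℕ) (d : ℕ) (α β ρ z N : ℂ)
    (h : ∀ s ≤ d, ((∑ j ∈ range (s + 1), w j * (d - j).choose (s - j) : ℕ) : ℂ) =
      ρ * ((d.factorial : ℂ)⁻¹ * (d.choose s : ℂ) * poch (α + β + d + 1) s *
        poch (β + 1 + s) (d - s))) :
    ∑ j ∈ range (d + 1), (w j : ℂ) * (-1) ^ j * (fall z j * fall (N - 1 - z) (d - j)) =
      (-1) ^ d * ρ * (hahnPoly α β d N).eval z := by
  rw [sum_fall_mul_fall, hahnPoly_eval, mul_assoc, mul_sum _ _ ρ]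
  congr 1
  refine sum_congr rfl fun s hs => ?_
  rw [← mul_assoc ρ, ← h s (Nat.lt_succ_iff.mp (mem_range.mp hs))]
  push_cast; rfl

/-- A Hahn polynomial with parameters `a, c ∈ ℕ` as a sum over pairs of falling factorials, with
weights `C(d + a + c, d + a - j) C(d, j)`. -/
theorem sum_fall_eq_hahnPoly_of_left (d a c : ℕ) (z N : ℂ) :
    ∑ j ∈ range (d + 1), (((d + a + c).choose (d + a - j) * d.choose j : ℕ) : ℂ) * (-1) ^ j *
        (fall z j * fall (N - 1 - z) (d - j)) =
      (-1) ^ d * (((d + a + c + d).choose (d + a) : ℂ) * ((d + a + c + d).choose d : ℂ)⁻¹) *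
        (hahnPoly a c d N).eval z := by
  refine sum_fall_eq_hahnPoly _ d a c _ z N fun s hs => ?_
  rw [sum_choose_mul_choose_of_left _ _ _ _ hs (by omega)]
  obtain ⟨f, rfl⟩ := Nat.exists_eq_add_of_le hs
  have e1 : (a : ℂ) + c + (s + f : ℕ) = (s + f + a + c : ℕ) := by push_cast; ring
  have e2 : (c : ℂ) + 1 + s = (c + s : ℕ) + 1 := by push_cast; ring
  rw [e1, e2, poch_natCast, poch_natCast]
  have c1 := cast_add_choose (s + f + a) (c + (s + f))
  have c2 := cast_add_choose (s + f) (a + c + (s + f))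
  have c3 := cast_add_choose (s + f + a) (c + s)
  rw [show s + f + a + (c + (s + f)) = s + f + a + c + (s + f) by ring] at c1
  rw [show s + f + (a + c + (s + f)) = s + f + a + c + (s + f) by ring] at c2
  rw [show s + f + a + (c + s) = s + f + a + c + s by ring] at c3
  rw [c1, c2]
  push_cast
  rw [c3, Nat.add_sub_cancel_left, show a + c + (s + f) = s + f + a + c by ring,
    show c + s + f = c + (s + f) by ring]
  have hf : ∀ n : ℕ, (n.factorial : ℂ) ≠ 0 := fun n => by exact_mod_cast n.factorial_ne_zero
  have := hf (s + f + a + c + (s + f))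
  have := hf (s + f)
  have := hf (s + f + a)
  have := hf (s + f + a + c)
  have := hf (c + s)
  have := hf (c + (s + f))
  field_simp

/-- A Hahn polynomial with parameters `a, c ∈ ℕ` as a sum over pairs of falling factorials, with
weights `C(d + c, d - j) C(d + a, j)`. -/
theorem sum_fall_eq_hahnPoly_of_right (d a c : ℕ) (z N : ℂ) :
    ∑ j ∈ range (d + 1), (((d + c).choose (d - j) * (d + a).choose j : ℕ) : ℂ) * (-1) ^ j *
        (fall z j * fall (N - 1 - z) (d - j)) =
      (-1) ^ d * (hahnPoly a c d N).eval z := by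
  rw [← mul_one ((-1 : ℂ) ^ d)]
  refine sum_fall_eq_hahnPoly _ d a c _ z N fun s hs => ?_
  rw [sum_choose_mul_choose_of_right _ _ _ _ hs]
  obtain ⟨f, rfl⟩ := Nat.exists_eq_add_of_le hs
  have e1 : (a : ℂ) + c + (s + f : ℕ) = (s + f + a + c : ℕ) := by push_cast; ring
  have e2 : (c : ℂ) + 1 + s = (c + s : ℕ) + 1 := by push_cast; ring
  rw [e1, e2, poch_natCast, poch_natCast]
  have c1 := cast_add_choose f (c + s)
  have c2 := cast_add_choose s (s + f + a + c)
  have c3 := cast_add_choose s f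
  rw [show f + (c + s) = s + f + c by ring] at c1
  rw [show s + f + c = s + f + c by ring] at c1
  rw [Nat.add_sub_cancel_left, show s + f + c - f + (s + f + a) = s + (s + f + a + c) by omega]
  push_cast
  rw [c1, c2, c3, show s + f + a + c + s = s + (s + f + a + c) by ring,
    show c + s + f = s + f + c by ring]
  have hf : ∀ n : ℕ, (n.factorial : ℂ) ≠ 0 := fun n => by exact_mod_cast n.factorial_ne_zero
  have := hf (s + f)
  have := hf (s + f + a + c)
  have := hf (c + s)
  have := hf s
  have := hf f
  field_simp

/-! ### Number operators, left ideals and derivations in a general algebra -/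

theorem commutator_mul {A : Type*} [Ring A] (T x y : A) :
    T * (x * y) - x * y * T = (T * x - x * T) * y + x * (T * y - y * T) := by
  noncomm_ring

section Weyl
variable {A : Type*} [Ring A] [Algebra ℂ A]

/-- The ideal is only a left ideal, so `x - y` has to be split off as the rightmost factor of `f(x)
- f(y)`; commutation of `x` and `y` allows this. -/
theorem Commute.aeval_sub_aeval_mem (I : Ideal A) {x y : A} (hc : Commute x y) (h : x - y ∈ I)
    (f : ℂ[X]) : aeval x f - aeval y f ∈ I := by
  induction f using Polynomial.induction_on with
  | C a => simp
  | add f g hf hg =>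
    rw [map_add, map_add, add_sub_add_comm]
    exact I.add_mem hf hg
  | monomial n a ih =>
    simp only [map_mul, aeval_C, map_pow, aeval_X] at ih ⊢
    have e : algebraMap ℂ A a * x ^ (n + 1) - algebraMap ℂ A a * y ^ (n + 1) =
        x * (algebraMap ℂ A a * x ^ n - algebraMap ℂ A a * y ^ n) +
          algebraMap ℂ A a * y ^ n * (x - y) := by
      have h1 : x * algebraMap ℂ A a = algebraMap ℂ A a * x := (Algebra.commutes a x).symm
      have h2 : y ^ n * x = x * y ^ n := ((hc.pow_right n).eq).symm
      rw [mul_sub, mul_sub, ← mul_assoc x, ← mul_assoc x, h1, mul_assoc _ (y ^ n) x, h2, pow_succ',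
        pow_succ]
      noncomm_ring
    rw [e]
    exact I.add_mem (I.mul_mem_left _ ih) (I.mul_mem_left _ h)

theorem aeval_mul_of_mul_eq {x y u : A} (h : x * u = u * y) (f : ℂ[X]) :
    aeval x f * u = u * aeval y f := by
  induction f using Polynomial.induction_on with
  | C a => simp [Algebra.commutes]
  | add f g hf hg => rw [map_add, map_add, add_mul, mul_add, hf, hg]
  | monomial n a ih =>
    have h3 : x ^ (n + 1) * u = u * y ^ (n + 1) := (SemiconjBy.pow_right (a := u) h.symm (n + 1)).symm
    simp only [map_mul, aeval_C, map_pow, aeval_X] at ih ⊢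
    rw [mul_assoc, h3, ← mul_assoc, Algebra.commutes, mul_assoc]

/-- The lowering operator shifts the number operator by one. This is the source of the shifts by `c`
in the Hahn argument and size. -/
theorem mul_pow_of_weyl {up um : A} {ε : ℂ} (hε : ε ≠ 0)
    (h : um * up = up * um + algebraMap ℂ A ε) (c : ℕ) :
    ε⁻¹ • (up * um) * um ^ c = um ^ c * (ε⁻¹ • (up * um) - algebraMap ℂ A c) := by
  induction c with
  | zero => simp
  | succ c ih =>
    have h1 : ε⁻¹ • (up * um) * um = um * (ε⁻¹ • (up * um) - 1) := by
      have h2 : up * um = um * up - algebraMap ℂ A ε := by rw [h]; abel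
      rw [mul_sub, mul_one, mul_smul_comm, smul_mul_assoc, ← mul_assoc um, h, add_mul, smul_add,
        ← Algebra.smul_def, smul_smul, inv_mul_cancel₀ hε, one_smul, add_sub_cancel_right]
    rw [pow_succ, ← mul_assoc, ih, mul_assoc, sub_mul, h1, mul_assoc, Algebra.commutes (c : ℂ) um,
      ← mul_sub, Nat.cast_succ, map_add, map_one, sub_sub, add_comm (1 : A)]

theorem pow_mul_pow_eq_aeval {up um : A} {ε : ℂ} (hε : ε ≠ 0)
    (h : um * up = up * um + algebraMap ℂ A ε) (j : ℕ) :
    up ^ j * um ^ j = ε ^ j • aeval (ε⁻¹ • (up * um)) (descPochhammer ℂ j) := by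
  induction j with
  | zero => simp
  | succ j ih =>
    have h1 := mul_pow_of_weyl hε h 1
    rw [pow_one] at h1
    rw [pow_succ', pow_succ, mul_assoc, ← mul_assoc _ _ um, ih, smul_mul_assoc,
      aeval_mul_of_mul_eq h1, mul_smul_comm, ← mul_assoc, descPochhammer_succ_left, map_mul,
      aeval_X, aeval_comp, smul_mul_assoc, smul_smul, pow_succ, mul_assoc (ε ^ j),
      mul_inv_cancel₀ hε, mul_one]
    simp

theorem pow_mul_pow_add_eq_aeval {up um : A} {ε : ℂ} (hε : ε ≠ 0)
    (h : um * up = up * um + algebraMap ℂ A ε) (j c : ℕ) :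
    up ^ j * um ^ (j + c) =
      um ^ c * ε ^ j • aeval (ε⁻¹ • (up * um) - algebraMap ℂ A c) (descPochhammer ℂ j) := by
  rw [pow_add, ← mul_assoc, pow_mul_pow_eq_aeval hε h, smul_mul_assoc,
    aeval_mul_of_mul_eq (mul_pow_of_weyl hε h c), mul_smul_comm]

/-- Transfers a scalar identity to the quotient by `I`: holding at every complex `z`, it is an
identity of polynomials and can be evaluated at `x`; then `N - 1 - x` is replaced by `y`, and `x` by
`X'`. -/
theorem sum_aeval_sub_mem (I : Ideal A) (L x y X' : A) (N : ℂ) (hxy : Commute x y)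
    (hxX : Commute X' x) (hX : X' - x ∈ I) (hy : y + x - algebraMap ℂ A (N - 1) ∈ I)
    (w : ℕ → ℂ) (d : ℕ) (κ : ℂ) (H : ℂ[X])
    (hH : ∀ z, ∑ j ∈ range (d + 1), w j * (-1) ^ j * (fall z j * fall (N - 1 - z) (d - j)) =
      κ * H.eval z) :
    κ • (L * aeval X' H) - ∑ j ∈ range (d + 1), (w j * (-1) ^ j) •
      (L * (aeval x (descPochhammer ℂ j) * aeval y (descPochhammer ℂ (d - j)))) ∈ I := by
  have e : ∑ j ∈ range (d + 1), C (w j * (-1) ^ j) * (descPochhammer ℂ j *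
      (descPochhammer ℂ (d - j)).comp (C (N - 1) - X)) = C κ * H := by
    refine Polynomial.funext fun z => ?_
    rw [eval_finsetSum, eval_mul, eval_C, ← hH z]
    simp [fall]
  have e' := congrArg (fun f => L * aeval x f) e
  simp only [map_sum, map_mul (aeval x), aeval_C, mul_sum, aeval_comp, map_sub (aeval x) (C (N - 1)) X,
    aeval_X] at e'
  have smem : ∀ (a : ℂ) {u : A}, u ∈ I → a • u ∈ I := fun a u hu => by
    rw [Algebra.smul_def]; exact I.mul_mem_left _ hu
  have h1 : κ • (L * aeval X' H) - κ • (L * aeval x H) ∈ I := by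
    rw [← smul_sub, ← mul_sub]
    exact smem _ (I.mul_mem_left _ (Commute.aeval_sub_aeval_mem I hxX hX H))
  have h2 : κ • (L * aeval x H) - ∑ j ∈ range (d + 1), (w j * (-1) ^ j) •
      (L * (aeval x (descPochhammer ℂ j) * aeval y (descPochhammer ℂ (d - j)))) ∈ I := by
    have e2 : κ • (L * aeval x H) = L * (algebraMap ℂ A κ * aeval x H) := by
      rw [← Algebra.smul_def, mul_smul_comm]
    rw [e2, ← e', ← sum_sub_distrib]
    refine I.sum_mem fun j _ => ?_
    rw [← Algebra.smul_def, mul_smul_comm, ← smul_sub, ← mul_sub, ← mul_sub]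
    refine smem _ (I.mul_mem_left _ (I.mul_mem_left _ (Commute.aeval_sub_aeval_mem I ?_ ?_ _)))
    · exact Commute.sub_left (Algebra.commute_algebraMap_left _ _) hxy
    · rw [← neg_mem_iff]
      convert hy using 1
      abel
  have := I.add_mem h1 h2
  rwa [sub_add_sub_cancel] at this

theorem smul_sub_smul_mem (I : Ideal A) {x y : A} (a : ℂ) (h : x - y ∈ I) :
    a • x - a • y ∈ I := by
  rw [← smul_sub, Algebra.smul_def]
  exact I.mul_mem_left _ h

theorem iterate_leibniz (D : A →ₗ[ℂ] A) (hD : ∀ x y, D (x * y) = D x * y + x * D y) (x y : A)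
    (k : ℕ) : D^[k] (x * y) =
      ∑ ij ∈ antidiagonal k, k.choose ij.1 • (D^[ij.1] x * D^[ij.2] y) := by
  induction k with
  | zero => simp
  | succ n ih =>
    rw [sum_antidiagonal_choose_succ_nsmul (M := A) (fun i j => D^[i] x * D^[j] y) n]
    simp only [Function.iterate_succ_apply', ih, map_sum, map_nsmul, hD, smul_add,
      sum_add_distrib]
    rw [add_comm, add_right_inj]
    refine sum_congr rfl fun ⟨i, j⟩ hij ↦ ?_
    rw [n.choose_symm_of_eq_add (HasAntidiagonal.mem_antidiagonal.1 hij).symm]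

theorem leibniz_pow_eq_zero (D : A →ₗ[ℂ] A) (hD : ∀ x y, D (x * y) = D x * y + x * D y) {v : A}
    (hv : D v = 0) (i : ℕ) : D (v ^ i) = 0 := by
  induction i with
  | zero =>
    have := hD 1 1
    simpa using this
  | succ i ih => rw [pow_succ, hD, ih, hv, zero_mul, mul_zero, add_zero]

theorem leibniz_pow (D : A →ₗ[ℂ] A) (hD : ∀ x y, D (x * y) = D x * y + x * D y) {u v : A}
    {a : ℂ} (hu : D u = a • v) (huv : Commute u v) (p : ℕ) :
    D (u ^ p) = (p * a) • (u ^ (p - 1) * v) := by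
  induction p with
  | zero => simpa using leibniz_pow_eq_zero D hD (v := 0) (map_zero D) 0
  | succ p ih =>
    rw [pow_succ, hD, ih, hu, mul_smul_comm, smul_mul_assoc, mul_assoc, ← huv.eq, ← mul_assoc,
      Nat.add_sub_cancel]
    rcases p with _ | p
    · simp
    · rw [Nat.add_sub_cancel, ← pow_succ, ← add_smul]
      congr 1
      push_cast
      ring

/-- On powers of `u` the derivation acts as `a v ∂/∂u`, with `v` behaving as a constant. -/
theorem iterate_leibniz_pow (D : A →ₗ[ℂ] A) (hD : ∀ x y, D (x * y) = D x * y + x * D y) {u v : A}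
    {a : ℂ} (hu : D u = a • v) (hv : D v = 0) (huv : Commute u v) (p i : ℕ) :
    D^[i] (u ^ p) = (p.descFactorial i * a ^ i : ℂ) • (u ^ (p - i) * v ^ i) := by
  induction i with
  | zero => simp
  | succ i ih =>
    rw [Function.iterate_succ_apply', ih, map_smul, hD, leibniz_pow D hD hu huv,
      leibniz_pow_eq_zero D hD hv, mul_zero, add_zero, smul_mul_assoc, smul_smul, mul_assoc _ v,
      ← pow_succ', Nat.sub_sub, Nat.descFactorial_succ]
    congr 1
    push_cast
    ring

theorem iterate_leibniz_pow_mul_pow (D : A →ₗ[ℂ] A)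
    (hD : ∀ x y, D (x * y) = D x * y + x * D y) {ap am bp bm : A} {a : ℂ} (h1 : D ap = a • bp)
    (h2 : D bp = 0) (h3 : D bm = -a • am) (h4 : D am = 0) (c1 : Commute ap bp)
    (c2 : Commute bm am) (c3 : Commute am bp) (p q k : ℕ) :
    D^[k] (ap ^ p * bm ^ q) = ∑ ij ∈ antidiagonal k,
      (k.factorial * a ^ k * (p.choose ij.1 * q.choose ij.2 : ℕ) * (-1) ^ ij.2 : ℂ) •
        ((ap ^ (p - ij.1) * am ^ ij.2) * (bp ^ ij.1 * bm ^ (q - ij.2))) := by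
  rw [iterate_leibniz D hD]
  refine sum_congr rfl fun ⟨i, j⟩ hij ↦ ?_
  obtain rfl := HasAntidiagonal.mem_antidiagonal.1 hij
  simp only
  rw [iterate_leibniz_pow D hD h1 h2 c1, iterate_leibniz_pow D hD h3 h4 c2, smul_mul_smul_comm,
    ← Nat.cast_smul_eq_nsmul ℂ, smul_smul]
  congr 1
  · rw [Nat.descFactorial_eq_factorial_mul_choose, Nat.descFactorial_eq_factorial_mul_choose]
    -- The Leibniz coefficient absorbs the `i!` and `j!` of the two falling factorials into one
    -- common `k!`.
    have h : ((i + j).factorial : ℂ) = (i + j).choose i * i.factorial * j.factorial := by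
      rw [Nat.choose_symm_add]
      exact_mod_cast (Nat.add_choose_mul_factorial_mul_factorial i j).symm
    rw [h, pow_add, neg_pow a]
    push_cast
    ring
  · have e1 := (c2.pow_pow (q - j) j).eq
    have e2 := (c3.pow_pow j i).eq
    rw [e1, mul_assoc, ← mul_assoc (bp ^ i), ← e2]
    simp only [mul_assoc]

end Weyl

/-! ### The derivation `Ad_{J₋}` on `W(ε)` -/

section Relations
variable (ε : ℝ)

theorem aM_mul_aP : aM ε * aP ε = aP ε * aM ε + algebraMap ℂ (W ε) ε := by
  have := RingQuot.mkAlgHom_rel ℂ (Rel.a (ε := ε))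
  rwa [map_mul, map_add, map_mul, AlgHom.commutes] at this

theorem bM_mul_bP : bM ε * bP ε = bP ε * bM ε + algebraMap ℂ (W ε) ε := by
  have := RingQuot.mkAlgHom_rel ℂ (Rel.b (ε := ε))
  rwa [map_mul, map_add, map_mul, AlgHom.commutes] at this

theorem commute_aP_bP : Commute (aP ε) (bP ε) := by
  have := RingQuot.mkAlgHom_rel ℂ (Rel.aPbP (ε := ε))
  rwa [map_mul, map_mul] at this

theorem commute_aP_bM : Commute (aP ε) (bM ε) := by
  have := RingQuot.mkAlgHom_rel ℂ (Rel.aPbM (ε := ε))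
  rwa [map_mul, map_mul] at this

theorem commute_aM_bP : Commute (aM ε) (bP ε) := by
  have := RingQuot.mkAlgHom_rel ℂ (Rel.aMbP (ε := ε))
  rwa [map_mul, map_mul] at this

theorem commute_aM_bM : Commute (aM ε) (bM ε) := by
  have := RingQuot.mkAlgHom_rel ℂ (Rel.aMbM (ε := ε))
  rwa [map_mul, map_mul] at this

/-- `Ad_T` as a linear map. -/
def adLin (T : W ε) : W ε →ₗ[ℂ] W ε := LinearMap.mulLeft ℂ T - LinearMap.mulRight ℂ T

theorem adLin_apply (T w : W ε) : adLin ε T w = T * w - w * T := rfl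

theorem adLin_mul (T x y : W ε) :
    adLin ε T (x * y) = adLin ε T x * y + x * adLin ε T y :=
  commutator_mul T x y

theorem adLin_Jm_aP : adLin ε (Jm ε) (aP ε) = (ε : ℂ) • bP ε := by
  rw [adLin_apply, Jm, mul_assoc, ← (commute_aP_bP ε).eq, ← mul_assoc, aM_mul_aP, add_mul,
    Algebra.smul_def, ← mul_assoc, add_sub_cancel_left]

theorem adLin_Jm_bP : adLin ε (Jm ε) (bP ε) = 0 := by
  rw [adLin_apply, Jm, ← mul_assoc, ← (commute_aM_bP ε).eq, sub_self]

theorem adLin_Jm_aM : adLin ε (Jm ε) (aM ε) = 0 := by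
  rw [adLin_apply, Jm, mul_assoc, ← (commute_aM_bP ε).eq, sub_self]

theorem adLin_Jm_bM : adLin ε (Jm ε) (bM ε) = (-ε : ℂ) • aM ε := by
  rw [adLin_apply, Jm, ← mul_assoc, ← (commute_aM_bM ε).eq, mul_assoc, mul_assoc, bM_mul_bP,
    mul_add, ← Algebra.commutes, Algebra.smul_def, sub_add_cancel_left, map_neg]
  exact (neg_mul (algebraMap ℂ (W ε) ε) (aM ε)).symm

theorem iterate_Ad_Jm (p q k : ℕ) : (Ad ε (Jm ε))^[k] (aP ε ^ p * bM ε ^ q) =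
    ∑ ij ∈ antidiagonal k,
      (k.factorial * ε ^ k * (p.choose ij.1 * q.choose ij.2 : ℕ) * (-1) ^ ij.2 : ℂ) •
        ((aP ε ^ (p - ij.1) * aM ε ^ ij.2) * (bP ε ^ ij.1 * bM ε ^ (q - ij.2))) :=
  iterate_leibniz_pow_mul_pow (adLin ε (Jm ε)) (adLin_mul ε _) (adLin_Jm_aP ε) (adLin_Jm_bP ε)
    (adLin_Jm_bM ε) (adLin_Jm_aM ε) (commute_aP_bP ε) (commute_aM_bM ε).symm (commute_aM_bP ε) p q k

end Relations

/-! ### Labels as natural numbers, and the expansion of `P(n,r,m)` -/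

section Labels

theorem toN_of_eq {x : ℚ} {a : ℕ} (h : x = a) : toN x = a := by
  rw [h, toN, Nat.floor_natCast]

theorem IsLabel.exists_nat {n r m : ℚ} (h : IsLabel n r m) : ∃ p q k l : ℕ, p + q = k + l ∧
    n + r = p ∧ n - r = q ∧ n - m = k ∧ n + m = l := by
  obtain ⟨⟨a, ha⟩, ⟨b, hb⟩, ⟨c, hc⟩, hr, hm⟩ := h
  rw [abs_le] at hr hm
  have hb0 : 0 ≤ b := by exact_mod_cast (by linarith : (0 : ℚ) ≤ b)
  have hc0 : 0 ≤ c := by exact_mod_cast (by linarith : (0 : ℚ) ≤ c)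
  have hb1 : 0 ≤ a - b := by exact_mod_cast (by push_cast; linarith : (0 : ℚ) ≤ ((a - b : ℤ) : ℚ))
  have hc1 : 0 ≤ a - c := by exact_mod_cast (by push_cast; linarith : (0 : ℚ) ≤ ((a - c : ℤ) : ℚ))
  refine ⟨b.toNat, (a - b).toNat, (a - c).toNat, c.toNat, by omega, ?_, ?_, ?_, ?_⟩
  · rw [hb]; exact_mod_cast (Int.toNat_of_nonneg hb0).symm
  · rw [show n - r = ((a - b : ℤ) : ℚ) by push_cast; linarith]
    exact_mod_cast (Int.toNat_of_nonneg hb1).symm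
  · rw [show n - m = ((a - c : ℤ) : ℚ) by push_cast; linarith]
    exact_mod_cast (Int.toNat_of_nonneg hc1).symm
  · rw [hc]; exact_mod_cast (Int.toNat_of_nonneg hc0).symm

end Labels

/-- Selects the terms with nonzero binomials. The bounds `i ≤ c₁ + a₁ + d` and `j ≤ c₂ + a₂ + d`
force `i ≥ a₁` and `j ≥ c₂`, since one of `c₁, c₂` and one of `a₁, a₂` is zero; the new index is `e
= j - c₂`. -/
theorem sum_antidiagonal_eq_sum_range {M : Type*} [AddCommMonoid M] (c₁ c₂ a₁ a₂ d : ℕ)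
    (hc : c₁ = 0 ∨ c₂ = 0) (ha : a₁ = 0 ∨ a₂ = 0) (g : ℕ × ℕ → M)
    (hg : ∀ i j, c₁ + a₁ + d < i ∨ c₂ + a₂ + d < j → g (i, j) = 0) :
    ∑ ij ∈ antidiagonal (a₁ + c₂ + d), g ij =
      ∑ e ∈ range (d + 1), g (a₁ + (d - e), e + c₂) := by
  have hinj : Set.InjOn (fun e => (a₁ + (d - e), e + c₂)) (range (d + 1) : Set ℕ) := by
    intro e _ e' _ h
    simp only [Prod.mk.injEq] at h
    omega
  rw [← sum_image (g := fun e => (a₁ + (d - e), e + c₂)) hinj]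
  symm
  refine sum_subset ?_ ?_
  · intro ij hij
    simp only [mem_image, mem_range] at hij
    obtain ⟨e, he, rfl⟩ := hij
    rw [HasAntidiagonal.mem_antidiagonal]
    simp only
    omega
  · rintro ⟨i, j⟩ hij hn
    refine hg i j ?_
    rw [HasAntidiagonal.mem_antidiagonal] at hij
    simp only at hij
    by_contra hcon
    refine hn (mem_image.mpr ⟨j - c₂, mem_range.mpr ?_, ?_⟩)
    · omega
    · simp only [Prod.mk.injEq]
      omega

theorem monomial_eq_aeval {ε : ℝ} (hε : ε ≠ 0) (c₁ c₂ a₁ a₂ e f : ℕ) :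
    (aP ε ^ (c₁ + e) * aM ε ^ (e + c₂)) * (bP ε ^ (a₁ + f) * bM ε ^ (f + a₂)) =
      (ε : ℂ) ^ (e + f) • (aP ε ^ c₁ * aM ε ^ c₂ * (bP ε ^ a₁ * bM ε ^ a₂) *
        (aeval ((ε : ℂ)⁻¹ • (aP ε * aM ε) - scal ε c₂) (descPochhammer ℂ e) *
          aeval ((ε : ℂ)⁻¹ • (bP ε * bM ε) - scal ε a₂) (descPochhammer ℂ f))) := by
  have hε' : (ε : ℂ) ≠ 0 := by exact_mod_cast hε
  have h1 := pow_mul_pow_add_eq_aeval hε' (aM_mul_aP ε) e c₂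
  have h2 := pow_mul_pow_add_eq_aeval hε' (bM_mul_bP ε) f a₂
  have ca : ∀ z ∈ ({bP ε, bM ε} : Set (W ε)),
      Commute z ((ε : ℂ)⁻¹ • (aP ε * aM ε) - algebraMap ℂ (W ε) c₂) := by
    rintro z (rfl | rfl)
    · exact (((commute_aP_bP ε).symm.mul_right (commute_aM_bP ε).symm).smul_right _).sub_right
        (Algebra.commute_algebraMap_right _ _)
    · exact (((commute_aP_bM ε).symm.mul_right (commute_aM_bM ε).symm).smul_right _).sub_right
        (Algebra.commute_algebraMap_right _ _)
  set x := (ε : ℂ)⁻¹ • (aP ε * aM ε) - algebraMap ℂ (W ε) c₂ with hx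
  have hcomm : aeval x (descPochhammer ℂ e) * (bP ε ^ a₁ * bM ε ^ a₂) =
      (bP ε ^ a₁ * bM ε ^ a₂) * aeval x (descPochhammer ℂ e) := by
    refine aeval_mul_of_mul_eq ?_ _
    exact ((((ca _ (by simp)).pow_left a₁).mul_left ((ca _ (by simp)).pow_left a₂)).eq).symm
  rw [pow_add (aP ε), pow_add (bP ε), mul_assoc (aP ε ^ c₁), mul_assoc (bP ε ^ a₁), h1, h2]
  simp only [mul_smul_comm, smul_mul_assoc, smul_smul]
  rw [mul_comm, ← pow_add, scal, scal, ← hx]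
  congr 1
  rw [← mul_assoc (bP ε ^ a₁), ← mul_assoc (aP ε ^ c₁), mul_assoc (aP ε ^ c₁ * aM ε ^ c₂),
    ← mul_assoc (aeval x _), hcomm]
  simp only [mul_assoc]

/-- One formula for all four cases: `c₁ - c₂ = r + m` and `a₁ - a₂ = r - m` are split into positive
and negative parts, which are the exponents of the monomial pulled out on the left. -/
theorem P_eq_sum {ε : ℝ} (hε : ε ≠ 0) {n r m : ℚ} (c₁ c₂ a₁ a₂ d : ℕ)
    (hc : c₁ = 0 ∨ c₂ = 0) (ha : a₁ = 0 ∨ a₂ = 0) (h1 : n + r = (c₁ + a₁ + d : ℕ))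
    (h2 : n - r = (c₂ + a₂ + d : ℕ)) (h3 : n - m = (a₁ + c₂ + d : ℕ))
    (h4 : n + m = (c₁ + a₂ + d : ℕ)) :
    P ε n r m = (((Real.sqrt (binom n m))⁻¹ : ℝ) : ℂ) • ((-1) ^ c₂ * (ε : ℂ) ^ d) •
      ∑ e ∈ range (d + 1), (((c₁ + a₁ + d).choose (a₁ + (d - e)) *
        (c₂ + a₂ + d).choose (e + c₂) : ℕ) * (-1) ^ e : ℂ) •
        (aP ε ^ c₁ * aM ε ^ c₂ * (bP ε ^ a₁ * bM ε ^ a₂) *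
        (aeval ((ε : ℂ)⁻¹ • (aP ε * aM ε) - scal ε c₂) (descPochhammer ℂ e) *
          aeval ((ε : ℂ)⁻¹ • (bP ε * bM ε) - scal ε a₂) (descPochhammer ℂ (d - e)))) := by
  have h5 : 2 * n = (a₁ + c₂ + d + (c₁ + a₂ + d) : ℕ) := by
    push_cast at *
    linarith
  rw [P, binom, toN_of_eq h1, toN_of_eq h2, toN_of_eq h3, toN_of_eq h4, toN_of_eq h5, iterate_Ad_Jm,
    sum_antidiagonal_eq_sum_range c₁ c₂ a₁ a₂ d hc ha, smul_smul, smul_sum, smul_sum]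
  · refine sum_congr rfl fun e he => ?_
    have he' : e ≤ d := Nat.lt_succ_iff.mp (mem_range.mp he)
    simp only
    rw [show c₁ + a₁ + d - (a₁ + (d - e)) = c₁ + e by omega,
      show c₂ + a₂ + d - (e + c₂) = d - e + a₂ by omega, monomial_eq_aeval hε, smul_smul, smul_smul,
      smul_smul, show e + (d - e) = d by omega]
    congr 1
    set k := a₁ + c₂ + d
    set l := c₁ + a₂ + d
    -- The factor `1/k!` cancels the `k!` from the Leibniz expansion, leaving the inverse square
    -- root of a binomial coefficient.
    have h6 : Real.sqrt ((l.factorial : ℝ) / ((k + l).factorial * k.factorial)) =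
        (Real.sqrt ((k + l).choose l))⁻¹ * (k.factorial : ℝ)⁻¹ := by
      have hk : (0 : ℝ) < k.factorial := by exact_mod_cast k.factorial_pos
      have hl : (l.factorial : ℝ) ≠ 0 := by exact_mod_cast l.factorial_ne_zero
      have hkl : ((k + l).factorial : ℝ) ≠ 0 := by exact_mod_cast (k + l).factorial_ne_zero
      have h7 : (k.factorial : ℝ)⁻¹ = Real.sqrt ((k.factorial : ℝ)⁻¹ ^ 2) :=
        (Real.sqrt_sq (inv_nonneg.mpr hk.le)).symm
      rw [Nat.choose_symm_add.symm, Nat.cast_add_choose, ← Real.sqrt_inv, h7,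
        ← Real.sqrt_mul (by positivity)]
      congr 1
      field_simp
    rw [h6]
    have hε' : (ε : ℂ) ≠ 0 := by exact_mod_cast hε
    have hk : (k.factorial : ℂ) ≠ 0 := by exact_mod_cast k.factorial_ne_zero
    push_cast
    field_simp
    ring
  · rintro i j (h | h)
    · simp [Nat.choose_eq_zero_of_lt h]
    · simp [Nat.choose_eq_zero_of_lt h]

/-! ### Reduction modulo the left ideal of `K₀ - R̂` -/

/-- Because `J₀ = a₊a₋ - K₀ + ε/2`, replacing `K₀` by `R̂` turns `(J₀ + R̂)/ε - 1/2` into `a₊a₋/ε`.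
-/
theorem kerRho_mem_hahnArg {ε : ℝ} (hε : ε ≠ 0) (R : ℝ) (c : ℚ) :
    hahnArg ε R c - ((ε : ℂ)⁻¹ • (aP ε * aM ε) + scal ε c) ∈ kerRho ε R := by
  have hε' : (ε : ℂ) ≠ 0 := by exact_mod_cast hε
  have e : hahnArg ε R c - ((ε : ℂ)⁻¹ • (aP ε * aM ε) + scal ε c) =
      (-(ε : ℂ)⁻¹) • (K0 ε - scal ε (Rhat ε R)) := by
    simp only [hahnArg, J0, K0, scal, Algebra.algebraMap_eq_smul_one]
    match_scalars <;> field_simp <;> ring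
  rw [e, Algebra.smul_def]
  exact Ideal.mul_mem_left _ _ (Ideal.subset_span rfl)

/-- Because `a₊a₋ + b₊b₋ = 2K₀ - ε`, the two number operators add up to `2R̂/ε - 1` in the quotient.
-/
theorem kerRho_mem_add {ε : ℝ} (hε : ε ≠ 0) (R : ℝ) (c c' : ℚ) :
    ((ε : ℂ)⁻¹ • (bP ε * bM ε) + scal ε c') + ((ε : ℂ)⁻¹ • (aP ε * aM ε) + scal ε c) -
      algebraMap ℂ (W ε) (hahnSize ε R (c + c') - 1) ∈ kerRho ε R := by
  have hε' : (ε : ℂ) ≠ 0 := by exact_mod_cast hε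
  have e : ((ε : ℂ)⁻¹ • (bP ε * bM ε) + scal ε c') + ((ε : ℂ)⁻¹ • (aP ε * aM ε) + scal ε c) -
      algebraMap ℂ (W ε) (hahnSize ε R (c + c') - 1) =
      (2 * (ε : ℂ)⁻¹) • (K0 ε - scal ε (Rhat ε R)) := by
    simp only [hahnSize, K0, scal, Algebra.algebraMap_eq_smul_one]
    push_cast
    match_scalars <;> field_simp
    ring
  rw [e, Algebra.smul_def]
  exact Ideal.mul_mem_left _ _ (Ideal.subset_span rfl)

/-- Reduces each case to the scalar identity `hH` and a comparison of constants `hκ`. Pulling out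
`a₋^c₂` shifts the argument by `s`; pulling out `b₋^a₂` as well shifts the size by `t`. -/
theorem hahn_sub_P_mem {ε : ℝ} (hε : ε ≠ 0) (R : ℝ) {n r m : ℚ} (c₁ c₂ a₁ a₂ d : ℕ)
    (hc : c₁ = 0 ∨ c₂ = 0) (ha : a₁ = 0 ∨ a₂ = 0) (h1 : n + r = (c₁ + a₁ + d : ℕ))
    (h2 : n - r = (c₂ + a₂ + d : ℕ)) (h3 : n - m = (a₁ + c₂ + d : ℕ))
    (h4 : n + m = (c₁ + a₂ + d : ℕ)) (α β s t : ℚ) (hs : s = -c₂) (ht : t = -c₂ - a₂) (κ κ' : ℂ)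
    (hH : ∀ z, ∑ e ∈ range (d + 1), (((c₁ + a₁ + d).choose (a₁ + (d - e)) *
        (c₂ + a₂ + d).choose (e + c₂) : ℕ) : ℂ) * (-1) ^ e *
          (fall z e * fall (hahnSize ε R t - 1 - z) (d - e)) =
      κ * (hahnPoly α β d (hahnSize ε R t)).eval z)
    (hκ : κ' = (((Real.sqrt (binom n m))⁻¹ : ℝ) : ℂ) * ((-1) ^ c₂ * (ε : ℂ) ^ d) * κ) :
    κ' • (aP ε ^ c₁ * aM ε ^ c₂ * (bP ε ^ a₁ * bM ε ^ a₂) *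
      hahn ε α β d (hahnArg ε R s) (hahnSize ε R t)) - P ε n r m ∈ kerRho ε R := by
  rw [P_eq_sum hε c₁ c₂ a₁ a₂ d hc ha h1 h2 h3 h4, hκ, mul_smul, mul_smul]
  refine smul_sub_smul_mem _ _ (smul_sub_smul_mem _ _ ?_)
  have ex : ((ε : ℂ)⁻¹ • (aP ε * aM ε) - scal ε c₂) = (ε : ℂ)⁻¹ • (aP ε * aM ε) + scal ε s := by
    rw [hs, sub_eq_add_neg]; simp [scal]
  have ey : ((ε : ℂ)⁻¹ • (bP ε * bM ε) - scal ε a₂) =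
      (ε : ℂ)⁻¹ • (bP ε * bM ε) + scal ε ((-a₂ : ℚ) : ℂ) := by
    rw [sub_eq_add_neg]; simp [scal]
  have cs : ∀ (z : W ε) (u : ℂ), Commute z (scal ε u) := fun z u =>
    Algebra.commute_algebraMap_right u z
  have cAB : Commute (aP ε * aM ε) (bP ε * bM ε) :=
    ((commute_aP_bP ε).mul_left (commute_aM_bP ε)).mul_right
      ((commute_aP_bM ε).mul_left (commute_aM_bM ε))
  rw [ex, ey, hahn]
  refine sum_aeval_sub_mem _ _ _ _ _ (hahnSize ε R t) ?_ ?_ (kerRho_mem_hahnArg hε R s) ?_ _ _ _ _ hH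
  · refine Commute.add_left (Commute.add_right ?_ (cs _ _)) (cs _ _).symm
    exact (cAB.smul_left _).smul_right _
  · refine Commute.add_right ?_ (cs _ _)
    refine Commute.smul_right ?_ _
    refine Commute.add_left (Commute.sub_left ?_ (cs _ _).symm) (cs _ _).symm
    refine Commute.smul_left (Commute.add_left ?_ (cs _ _).symm) _
    exact ((Commute.refl _).sub_left cAB.symm).smul_left _
  · rw [show t = s + -(a₂ : ℚ) by rw [hs, ht]; ring]
    exact kerRho_mem_add hε R s (-a₂)

/-! ### Sums of words and their derivatives -/

section Symmetric
variable {A : Type*} [Ring A] (x₁ x₂ x₃ x₄ : A)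

/-- The sum of all words of length `N` with prescribed numbers of letters `x₁, x₂, x₃, x₄`; it
vanishes if one of these numbers is negative. -/
def wordSum : ℕ → ℤ → ℤ → ℤ → ℤ → A
  | 0, s, t, u, v => if s = 0 ∧ t = 0 ∧ u = 0 ∧ v = 0 then 1 else 0
  | N + 1, s, t, u, v => x₁ * wordSum N (s - 1) t u v + x₂ * wordSum N s (t - 1) u v +
      x₃ * wordSum N s t (u - 1) v + x₄ * wordSum N s t u (v - 1)

theorem wordSum_eq_zero (N : ℕ) : ∀ s t u v : ℤ, s < 0 ∨ t < 0 ∨ u < 0 ∨ v < 0 →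
    wordSum x₁ x₂ x₃ x₄ N s t u v = 0 := by
  induction N with
  | zero =>
    intro s t u v h
    rw [wordSum, if_neg]
    omega
  | succ N ih =>
    intro s t u v h
    rw [wordSum, ih (s - 1) t u v (by omega), ih s (t - 1) u v (by omega),
      ih s t (u - 1) v (by omega), ih s t u (v - 1) (by omega)]
    simp

/-- Turning one letter `x₂` into `x₄` produces each target word once for every one of its `v + 1`
letters `x₄`; likewise `x₃` into `x₁`. Integer counts make the boundary terms vanish without
separate cases. -/
theorem leibniz_wordSum [Algebra ℂ A] (D : A →ₗ[ℂ] A) (hD : ∀ x y, D (x * y) = D x * y + x * D y) {a : ℂ}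
    (h₁ : D x₁ = 0) (h₂ : D x₂ = a • x₄) (h₃ : D x₃ = -a • x₁) (h₄ : D x₄ = 0) (N : ℕ) :
    ∀ s t u v : ℤ, D (wordSum x₁ x₂ x₃ x₄ N s t u v) =
      a • (((v : ℂ) + 1) • wordSum x₁ x₂ x₃ x₄ N s (t - 1) u (v + 1) -
        ((s : ℂ) + 1) • wordSum x₁ x₂ x₃ x₄ N (s + 1) t (u - 1) v) := by
  induction N with
  | zero =>
    intro s t u v
    have h1 : D 1 = 0 := by simpa using leibniz_pow_eq_zero D hD h₁ 0
    -- The empty word occurs here only for `v = -1`, where the coefficient is zero.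
    have e1 : ((v : ℂ) + 1) • wordSum x₁ x₂ x₃ x₄ 0 s (t - 1) u (v + 1) = 0 := by
      rw [wordSum]
      split_ifs with h
      · have : (v : ℂ) + 1 = 0 := by exact_mod_cast h.2.2.2
        rw [this, zero_smul]
      · exact smul_zero _
    have e2 : ((s : ℂ) + 1) • wordSum x₁ x₂ x₃ x₄ 0 (s + 1) t (u - 1) v = 0 := by
      rw [wordSum]
      split_ifs with h
      · have : (s : ℂ) + 1 = 0 := by exact_mod_cast h.1
        rw [this, zero_smul]
      · exact smul_zero _
    rw [e1, e2, wordSum]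
    split_ifs <;> simp [h1]
  | succ N ih =>
    intro s t u v
    simp only [wordSum, map_add, hD, h₁, h₂, h₃, h₄, ih]
    push_cast
    simp only [sub_add_cancel, add_sub_cancel_right, mul_smul_comm, smul_mul_assoc, mul_sub,
      zero_mul, smul_sub]
    module

/-- All `C(N,p)` words are equal because the two letters commute; splitting by first letter is
Pascal's rule. -/
theorem wordSum_pow_mul_pow [Algebra ℂ A] (h : Commute x₂ x₃) (N : ℕ) : ∀ p q : ℕ, p + q = N →
    wordSum x₁ x₂ x₃ x₄ N 0 p q 0 = (N.choose p : ℂ) • (x₂ ^ p * x₃ ^ q) := by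
  induction N with
  | zero =>
    intro p q hpq
    obtain ⟨rfl, rfl⟩ : p = 0 ∧ q = 0 := by omega
    simp [wordSum]
  | succ N ih =>
    intro p q hpq
    rw [wordSum, wordSum_eq_zero _ _ _ _ N (0 - 1) _ _ _ (by omega),
      wordSum_eq_zero _ _ _ _ N 0 _ _ (0 - 1) (by omega), mul_zero, mul_zero, zero_add, add_zero]
    have e1 : x₂ * wordSum x₁ x₂ x₃ x₄ N 0 (p - 1) q 0 =
        ((if p = 0 then 0 else N.choose (p - 1) : ℕ) : ℂ) • (x₂ ^ p * x₃ ^ q) := by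
      rcases p with _ | p
      · rw [wordSum_eq_zero _ _ _ _ N _ _ _ _ (by omega)]; simp
      · have := ih p q (by omega)
        push_cast
        rw [add_sub_cancel_right, this, mul_smul_comm, ← mul_assoc, ← pow_succ']
    have e2 : x₃ * wordSum x₁ x₂ x₃ x₄ N 0 p (q - 1) 0 =
        ((if q = 0 then 0 else N.choose p : ℕ) : ℂ) • (x₂ ^ p * x₃ ^ q) := by
      rcases q with _ | q
      · rw [wordSum_eq_zero _ _ _ _ N _ _ _ _ (by omega)]; simp
      · have := ih p q (by omega)
        push_cast
        rw [add_sub_cancel_right, this, mul_smul_comm, ← mul_assoc, ← (h.pow_left p).eq, mul_assoc,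
          ← pow_succ']
    rw [e1, e2, ← add_smul]
    congr 1
    rcases p with _ | p
    · have : q ≠ 0 := by omega
      simp [this]
    · rcases q with _ | q
      · obtain rfl : p = N := by omega
        simp
      · rw [Nat.choose_succ_succ]
        push_cast
        simp

end Symmetric

theorem sum_gen {M : Type*} [AddCommMonoid M] (f : Gen → M) :
    ∑ g, f g = f Gen.aM + f Gen.aP + f Gen.bM + f Gen.bP := by
  have : (univ : Finset Gen) = {Gen.aM, Gen.aP, Gen.bM, Gen.bP} := rfl
  rw [this]
  simp [add_assoc]

/-- The exponent of a single letter. -/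
def letterExpo : Gen → Expo
  | Gen.aM => (1, 0, 0, 0)
  | Gen.aP => (0, 1, 0, 0)
  | Gen.bM => (0, 0, 1, 0)
  | Gen.bP => (0, 0, 0, 1)

theorem wordExpo_cons {N : ℕ} (g : Gen) (w : Fin N → Gen) :
    wordExpo (Fin.cons g w : Fin (N + 1) → Gen) = letterExpo g + wordExpo w := by
  simp only [wordExpo, Fin.card_filter_univ_succ, Fin.cons_zero, Fin.cons_succ]
  cases g <;> simp [letterExpo, add_comm]

theorem sum_word_eq_wordSum (ε : ℝ) (N : ℕ) : ∀ s t u v : ℤ,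
    (∑ w : Fin N → Gen, if ((wordExpo w).1 : ℤ) = s ∧ ((wordExpo w).2.1 : ℤ) = t ∧
      ((wordExpo w).2.2.1 : ℤ) = u ∧ ((wordExpo w).2.2.2 : ℤ) = v then
        (List.ofFn fun i => gen ε (w i)).prod else 0) =
      wordSum (aM ε) (aP ε) (bM ε) (bP ε) N s t u v := by
  induction N with
  | zero =>
    intro s t u v
    simp [wordSum, wordExpo, eq_comm]
  | succ N ih =>
    intro s t u v
    rw [← (Fin.consEquiv fun _ => Gen).sum_comp, Fintype.sum_prod_type, sum_gen, wordSum, ← ih, ← ih,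
      ← ih, ← ih, mul_sum, mul_sum, mul_sum, mul_sum]
    congr 1
    · congr 1
      · congr 1
        all_goals
          refine sum_congr rfl fun w _ => ?_
          simp [Fin.consEquiv, wordExpo_cons, List.ofFn_succ, letterExpo, mul_ite,
            eq_sub_iff_add_eq, add_comm, aM, aP]
      · refine sum_congr rfl fun w _ => ?_
        simp [Fin.consEquiv, wordExpo_cons, List.ofFn_succ, letterExpo, mul_ite,
            eq_sub_iff_add_eq, add_comm, bM]
    · refine sum_congr rfl fun w _ => ?_
      simp [Fin.consEquiv, wordExpo_cons, List.ofFn_succ, letterExpo, mul_ite,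
            eq_sub_iff_add_eq, add_comm, bP]

theorem S_eq_wordSum (ε : ℝ) (s t u v : ℕ) :
    S ε (s, t, u, v) = wordSum (aM ε) (aP ε) (bM ε) (bP ε) (s + t + u + v) s t u v := by
  rw [← sum_word_eq_wordSum, S, sum_filter]
  refine sum_congr rfl fun w _ => ?_
  congr 1
  simp [Prod.ext_iff]

/-! ### `Ad_{J₋}` preserves the traceless symmetric polynomials -/

/-- The coefficients of `ε⁻¹ Ad_{J₋} S(s,t,u,v)` with respect to the `S`. -/
def adBasis : Expo → (Expo →₀ ℂ) := fun (s, t, u, v) =>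
  (if 1 ≤ t then Finsupp.single (s, t - 1, u, v + 1) ((v : ℂ) + 1) else 0) -
  (if 1 ≤ u then Finsupp.single (s + 1, t, u - 1, v) ((s : ℂ) + 1) else 0)

/-- The operator `ε⁻¹ Ad_{J₋}` on coefficients with respect to the `S`. -/
def adCoeff : (Expo →₀ ℂ) →ₗ[ℂ] (Expo →₀ ℂ) := Finsupp.linearCombination ℂ adBasis

theorem sym_single (ε : ℝ) (e : Expo) (c : ℂ) : sym ε (Finsupp.single e c) = c • S ε e :=
  Finsupp.linearCombination_single ℂ c e

theorem tr_single (e : Expo) (c : ℂ) : tr (Finsupp.single e c) = c • trBasis e :=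
  Finsupp.linearCombination_single ℂ c e

theorem adCoeff_single (e : Expo) (c : ℂ) : adCoeff (Finsupp.single e c) = c • adBasis e :=
  Finsupp.linearCombination_single ℂ c e

theorem adLin_S (ε : ℝ) (e : Expo) : adLin ε (Jm ε) (S ε e) = (ε : ℂ) • sym ε (adBasis e) := by
  obtain ⟨s, t, u, v⟩ := e
  rw [S_eq_wordSum, leibniz_wordSum _ _ _ _ _ (adLin_mul ε _) (adLin_Jm_aM ε) (adLin_Jm_aP ε)
    (adLin_Jm_bM ε) (adLin_Jm_bP ε), adBasis, map_sub]
  congr 2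
  · split_ifs with h
    · obtain ⟨t, rfl⟩ := Nat.exists_eq_add_of_le' h
      rw [sym_single, S_eq_wordSum]
      congr 2
      · omega
      · push_cast; ring
    · rw [wordSum_eq_zero _ _ _ _ _ _ _ _ _ (by omega), map_zero, smul_zero]
  · split_ifs with h
    · obtain ⟨u, rfl⟩ := Nat.exists_eq_add_of_le' h
      rw [sym_single, S_eq_wordSum]
      congr 2
      · omega
      · push_cast; ring
    · rw [wordSum_eq_zero _ _ _ _ _ _ _ _ _ (by omega), map_zero, smul_zero]

theorem adLin_sym (ε : ℝ) (f : Expo →₀ ℂ) :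
    adLin ε (Jm ε) (sym ε f) = (ε : ℂ) • sym ε (adCoeff f) := by
  have : adLin ε (Jm ε) ∘ₗ sym ε = (ε : ℂ) • (sym ε ∘ₗ adCoeff) := by
    refine Finsupp.lhom_ext fun e c => ?_
    rw [LinearMap.comp_apply, LinearMap.smul_apply, LinearMap.comp_apply, sym_single,
      adCoeff_single, map_smul, map_smul, adLin_S, smul_comm]
  exact LinearMap.congr_fun this f

/-- The reason `Ad_{J₋}` preserves `Ψ`. The two routes produce `S(s,t-2,u,v)` and `S(s,t,u-2,v)`
type index shifts with the same coefficients, except at `S(s,t-1,u-1,v)`, where removing an `a`-pair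
and removing a `b`-pair contribute `s + 1` and `v + 1` with opposite signs, giving `2(v - s)` both
ways. -/
theorem tr_adBasis (e : Expo) : tr (adBasis e) = adCoeff (trBasis e) := by
  obtain ⟨s, t, u, v⟩ := e
  -- Opaque basis vectors make every case a linear identity that `module` can check. The indices `t`
  -- and `u` can be lowered twice, hence the separate values 0 and 1 in the case split.
  obtain ⟨δ, hδ⟩ : ∃ δ : Expo → (Expo →₀ ℂ), ∀ e c, Finsupp.single e c = c • δ e :=
    ⟨fun e => Finsupp.single e 1, by simp⟩
  have htr : ∀ e, tr (δ e) = trBasis e := fun e => by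
    simpa [hδ] using tr_single e 1
  have had : ∀ e, adCoeff (δ e) = adBasis e := fun e => by
    simpa [hδ] using adCoeff_single e 1
  rcases s with _ | s <;> rcases t with _ | _ | t <;> rcases u with _ | _ | u <;>
    rcases v with _ | v <;>
    simp [adBasis, trBasis, hδ, htr, had] <;> module

theorem tr_adCoeff (f : Expo →₀ ℂ) : tr (adCoeff f) = adCoeff (tr f) := by
  have : tr ∘ₗ adCoeff = adCoeff ∘ₗ tr := by
    refine Finsupp.lhom_ext fun e c => ?_
    rw [LinearMap.comp_apply, LinearMap.comp_apply, adCoeff_single, tr_single, map_smul, map_smul,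
      tr_adBasis]
  exact LinearMap.congr_fun this f

theorem adLin_mem_Psi (ε : ℝ) {x : W ε} (hx : x ∈ Psi ε) : adLin ε (Jm ε) x ∈ Psi ε := by
  obtain ⟨f, hf, rfl⟩ := hx
  rw [adLin_sym, ← map_smul]
  refine Submodule.mem_map_of_mem ?_
  rw [SetLike.mem_coe, LinearMap.mem_ker] at hf
  rw [LinearMap.mem_ker, map_smul, tr_adCoeff, hf, map_zero, smul_zero]

/-- With neither `a₋` nor `b₊` present, no pair can be removed and the trace is zero. -/
theorem pow_mul_pow_mem_Psi (ε : ℝ) (p q : ℕ) : aP ε ^ p * bM ε ^ q ∈ Psi ε := by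
  refine ⟨Finsupp.single (0, p, q, 0) (((p + q).choose p : ℂ)⁻¹), ?_, ?_⟩
  · rw [SetLike.mem_coe, LinearMap.mem_ker, tr_single, trBasis]
    simp
  · have h : ((p + q).choose p : ℂ) ≠ 0 := by
      exact_mod_cast (Nat.choose_pos (Nat.le_add_right p q)).ne'
    have h1 := wordSum_pow_mul_pow (aM ε) _ _ (bP ε) (commute_aP_bM ε) (p + q) p q rfl
    have h2 := S_eq_wordSum ε 0 p q 0
    simp only [Nat.cast_zero, zero_add, add_zero] at h2
    rw [sym_single, h2, h1, smul_smul, inv_mul_cancel₀ h, one_smul]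

theorem P_mem_Psi (ε : ℝ) (n r m : ℚ) : P ε n r m ∈ Psi ε := by
  refine Submodule.smul_mem _ _ ?_
  generalize toN (n - m) = k
  induction k with
  | zero => exact pow_mul_pow_mem_Psi ε _ _
  | succ k ih =>
    rw [Function.iterate_succ_apply']
    exact adLin_mem_Psi ε ih

end FuzzyPsi

end

/-! ### The four cases -/

theorem mainTheorem5 (ε R : ℝ) (hε : ε ≠ 0) (hR : 0 ≤ R) (n r m : ℚ) (h : IsLabel n r m) :
    (-r ≤ m → m ≤ r →
      RhoEq ε R
        ((((-1) ^ toN (n - r) * ε ^ toN (n - r) * Real.sqrt (binom n m) * (binom n r)⁻¹ : ℝ) : ℂ) •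
          (aP ε ^ toN (r + m) * bP ε ^ toN (r - m) *
            hahn ε (r - m) (r + m) (toN (n - r)) (hahnArg ε R 0) (hahnSize ε R 0)))
        (P ε n r m)) ∧
    (-m ≤ r → r ≤ m →
      RhoEq ε R
        ((((-1) ^ toN (n - m) * ε ^ toN (n - m) * (Real.sqrt (binom n m))⁻¹ : ℝ) : ℂ) •
          (aP ε ^ toN (r + m) * bM ε ^ toN (m - r) *
            hahn ε (m - r) (r + m) (toN (n - m)) (hahnArg ε R 0) (hahnSize ε R (r - m))))
        (P ε n r m)) ∧
    (m ≤ r → r ≤ -m →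
      RhoEq ε R
        ((((-1) ^ toN (n - r) * ε ^ toN (n + m) * (Real.sqrt (binom n m))⁻¹ : ℝ) : ℂ) •
          (aM ε ^ toN (-r - m) * bP ε ^ toN (r - m) *
            hahn ε (r - m) (-r - m) (toN (n + m)) (hahnArg ε R (r + m)) (hahnSize ε R (r + m))))
        (P ε n r m)) ∧
    (r ≤ m → m ≤ -r →
      RhoEq ε R
        ((((-1) ^ toN (n - m) * ε ^ toN (n + r) * Real.sqrt (binom n m) * (binom n r)⁻¹ : ℝ) : ℂ) •
          (aM ε ^ toN (-r - m) * bM ε ^ toN (m - r) *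
            hahn ε (m - r) (-r - m) (toN (n + r)) (hahnArg ε R (r + m)) (hahnSize ε R (2 * r))))
        (P ε n r m)) := by
  obtain ⟨p, q, k, l, hpq, h1, h2, h3, h4⟩ := h.exists_nat
  have hn : 2 * n = (p + q : ℕ) := by push_cast; linarith
  have hbin : binom n m = (p + q).choose l := by rw [binom, toN_of_eq hn, toN_of_eq h4]
  have hbin' : binom n r = (p + q).choose p := by rw [binom, toN_of_eq hn, toN_of_eq h1]
  have hl : l ≤ p + q := by omega
  have hB : 0 < binom n m := by rw [hbin]; exact_mod_cast Nat.choose_pos hl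
  -- In the first and last cases the Hahn identity contributes `binom n m / binom n r`, which turns
  -- the inverse square root into a square root.
  have hsq : Real.sqrt (binom n m) = (Real.sqrt (binom n m))⁻¹ * binom n m := by
    have := Real.sqrt_pos.mpr hB
    field_simp
    exact Real.sq_sqrt hB.le
  have hsq' := congrArg Complex.ofReal hsq
  have hrk : r + m = (p : ℚ) - k := by linarith
  have hrl : r - m = (p : ℚ) - l := by linarith
  refine ⟨fun hm1 hm2 => ⟨P_mem_Psi ε n r m, ?_⟩, fun hm1 hm2 => ⟨P_mem_Psi ε n r m, ?_⟩,
    fun hm1 hm2 => ⟨P_mem_Psi ε n r m, ?_⟩, fun hm1 hm2 => ⟨P_mem_Psi ε n r m, ?_⟩⟩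
  -- Smallest label `d = q = n - r`; the monomial is `a₊^c b₊^a`.
  · obtain ⟨c, rfl⟩ : ∃ c, p = k + c := Nat.exists_eq_add_of_le (by
      exact_mod_cast (by linarith : (k : ℚ) ≤ p))
    obtain ⟨a, rfl⟩ : ∃ a, k = q + a := Nat.exists_eq_add_of_le (by
      exact_mod_cast (by linarith : (q : ℚ) ≤ k))
    obtain rfl : l = c + q := by omega
    have ec : r + m = (c : ℕ) := by rw [hrk]; push_cast; ring
    have ea : r - m = (a : ℕ) := by rw [hrl]; push_cast; ring
    have key := hahn_sub_P_mem hε R (n := n) (r := r) (m := m) c 0 a 0 q (Or.inr rfl) (Or.inr rfl)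
      (by rw [h1]; push_cast; ring) (by rw [h2]; push_cast; ring) (by rw [h3]; push_cast; ring)
      (by rw [h4]; push_cast; ring) (r - m) (r + m) 0 0 (by simp) (by simp) _
      ((((-1) ^ q * ε ^ q * Real.sqrt (binom n m) * (binom n r)⁻¹ : ℝ) : ℂ)) (by
        intro z
        rw [ea, ec]
        have := sum_fall_eq_hahnPoly_of_left q a c z (hahnSize ε R 0)
        push_cast at this ⊢
        rw [← this]
        refine Finset.sum_congr rfl fun e he => ?_
        have he' : e ≤ q := Nat.lt_succ_iff.mp (Finset.mem_range.mp he)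
        rw [show a + (q - e) = q + a - e by omega, show c + a + q = q + a + c by ring,
          show 0 + 0 + q = q by ring, add_zero]) (by
        have e1 : (q + a + c + q).choose (q + a) = (q + a + c + q).choose (c + q) := by
          rw [← Nat.choose_symm_of_eq_add]; ring
        have e2 : (q + a + c + q).choose q = (q + a + c + q).choose (q + a + c) := by
          rw [← Nat.choose_symm_of_eq_add]; ring
        rw [e1, e2]
        generalize Real.sqrt (binom n m) = σ at hsq'
        rw [hbin] at hsq'
        rw [hbin']
        push_cast at hsq' ⊢
        linear_combination ((-1) ^ q * ε ^ q * ((q + a + c + q).choose (q + a + c) : ℂ)⁻¹) * hsq')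
    rw [toN_of_eq h2, toN_of_eq ec, toN_of_eq ea]
    simpa using key
  -- Smallest label `d = k = n - m`; the monomial is `a₊^c b₋^a`.
  · obtain ⟨c, rfl⟩ : ∃ c, p = k + c := Nat.exists_eq_add_of_le (by
      exact_mod_cast (by linarith : (k : ℚ) ≤ p))
    obtain ⟨a, rfl⟩ : ∃ a, q = k + a := Nat.exists_eq_add_of_le (by
      exact_mod_cast (by linarith : (k : ℚ) ≤ q))
    obtain rfl : l = k + a + c := by omega
    have ec : r + m = (c : ℕ) := by rw [hrk]; push_cast; ring
    have ea : m - r = (a : ℕ) := by rw [← neg_sub, hrl]; push_cast; ring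
    have key := hahn_sub_P_mem hε R (n := n) (r := r) (m := m) c 0 0 a k (Or.inr rfl) (Or.inl rfl)
      (by rw [h1]; push_cast; ring) (by rw [h2]; push_cast; ring) (by rw [h3]; push_cast; ring)
      (by rw [h4]; push_cast; ring) (m - r) (r + m) 0 (r - m) (by simp)
      (by rw [← neg_sub m r, ea]; simp) _
      ((((-1) ^ k * ε ^ k * (Real.sqrt (binom n m))⁻¹ : ℝ) : ℂ)) (by
        intro z
        rw [ea, ec]
        have := sum_fall_eq_hahnPoly_of_right k a c z (hahnSize ε R (r - m))
        push_cast at this ⊢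
        rw [← this]
        refine Finset.sum_congr rfl fun e he => ?_
        rw [show 0 + a + k = k + a by ring, show c + 0 + k = k + c by ring, zero_add, add_zero]) (by
        push_cast
        ring)
    rw [toN_of_eq h3, toN_of_eq ec, toN_of_eq ea]
    simpa using key
  -- Smallest label `d = l = n + m`; the monomial is `a₋^c b₊^a`. Symmetry of both binomials brings
  -- the weights to the required form.
  · obtain ⟨c, rfl⟩ : ∃ c, k = p + c := Nat.exists_eq_add_of_le (by
      exact_mod_cast (by linarith : (p : ℚ) ≤ k))
    obtain ⟨a, rfl⟩ : ∃ a, p = l + a := Nat.exists_eq_add_of_le (by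
      exact_mod_cast (by linarith : (l : ℚ) ≤ p))
    obtain rfl : q = l + c := by omega
    have ec' : r + m = -(c : ℚ) := by rw [hrk]; push_cast; ring
    have ec : -r - m = (c : ℕ) := by rw [← neg_add', ec', neg_neg]
    have ea : r - m = (a : ℕ) := by rw [hrl]; push_cast; ring
    have key := hahn_sub_P_mem hε R (n := n) (r := r) (m := m) 0 c a 0 l (Or.inl rfl) (Or.inr rfl)
      (by rw [h1]; push_cast; ring) (by rw [h2]; push_cast; ring) (by rw [h3]; push_cast; ring)
      (by rw [h4]; push_cast; ring) (r - m) (-r - m) (r + m) (r + m) ec' (by rw [ec']; simp) _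
      ((((-1) ^ (l + c) * ε ^ l * (Real.sqrt (binom n m))⁻¹ : ℝ) : ℂ)) (by
        intro z
        rw [ea, ec]
        have := sum_fall_eq_hahnPoly_of_right l a c z (hahnSize ε R (r + m))
        push_cast at this ⊢
        rw [← this]
        refine Finset.sum_congr rfl fun e he => ?_
        have he' : e ≤ l := Nat.lt_succ_iff.mp (Finset.mem_range.mp he)
        have e1 : (0 + a + l).choose (a + (l - e)) = (l + a).choose e := by
          rw [show 0 + a + l = l + a by ring, ← Nat.choose_symm_of_eq_add]; omega
        have e2 : (c + 0 + l).choose (e + c) = (l + c).choose (l - e) := by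
          rw [show c + 0 + l = l + c by ring, ← Nat.choose_symm_of_eq_add]; omega
        rw [e1, e2, mul_comm ((l + a).choose e : ℂ)]) (by
        push_cast
        ring)
    rw [toN_of_eq h2, toN_of_eq h4, toN_of_eq ec, toN_of_eq ea]
    simpa using key
  -- Smallest label `d = p = n + r`; the monomial is `a₋^c b₋^a`.
  · obtain ⟨c, rfl⟩ : ∃ c, k = p + c := Nat.exists_eq_add_of_le (by
      exact_mod_cast (by linarith : (p : ℚ) ≤ k))
    obtain ⟨a, rfl⟩ : ∃ a, l = p + a := Nat.exists_eq_add_of_le (by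
      exact_mod_cast (by linarith : (p : ℚ) ≤ l))
    obtain rfl : q = p + a + c := by omega
    have ec' : r + m = -(c : ℚ) := by rw [hrk]; push_cast; ring
    have ec : -r - m = (c : ℕ) := by rw [← neg_add', ec', neg_neg]
    have ea : m - r = (a : ℕ) := by rw [← neg_sub, hrl]; push_cast; ring
    have key := hahn_sub_P_mem hε R (n := n) (r := r) (m := m) 0 c 0 a p (Or.inl rfl) (Or.inl rfl)
      (by rw [h1]; push_cast; ring) (by rw [h2]; push_cast; ring) (by rw [h3]; push_cast; ring)
      (by rw [h4]; push_cast; ring) (m - r) (-r - m) (r + m) (2 * r) ec' (by linarith) _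
      ((((-1) ^ (p + c) * ε ^ p * Real.sqrt (binom n m) * (binom n r)⁻¹ : ℝ) : ℂ)) (by
        intro z
        rw [ea, ec]
        have := sum_fall_eq_hahnPoly_of_left p a c z (hahnSize ε R (2 * r))
        push_cast at this ⊢
        rw [← this]
        refine Finset.sum_congr rfl fun e he => ?_
        have he' : e ≤ p := Nat.lt_succ_iff.mp (Finset.mem_range.mp he)
        have e1 : (0 + 0 + p).choose (0 + (p - e)) = p.choose e := by
          simp only [zero_add, Nat.choose_symm he']
        have e2 : (c + a + p).choose (e + c) = (p + a + c).choose (p + a - e) := by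
          rw [show c + a + p = p + a + c by ring, ← Nat.choose_symm_of_eq_add]; omega
        rw [e1, e2, mul_comm (p.choose e : ℂ)]) (by
        generalize Real.sqrt (binom n m) = σ at hsq'
        rw [hbin] at hsq'
        rw [hbin', show p + a + c + p = p + (p + a + c) by ring]
        push_cast at hsq' ⊢
        linear_combination ((-1) ^ (p + c) * ε ^ p * ((p + (p + a + c)).choose p : ℂ)⁻¹) * hsq')
    rw [toN_of_eq h1, toN_of_eq h3, toN_of_eq ec, toN_of_eq ea]
    simpa using key
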